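/- Let $n\ge 0$ be an integer, let $\mathbb{C}_n[x]$ be the space of complex polynomials of degree at most $n$, and let $T:\mathbb{C}_n[x]\to\mathbb{C}[x]$ be a nonzero linear operator. Its $n$-th Fuchs index is the integer $$\rho=\max_{0\le j\le n}\bigl(\deg T(x^j)-j\bigr),\qquad \deg 0=-\infty,$$ and $T$ is called non-degenerate if $\deg T(x^n)-n=\rho$. With $T$ acting on the variable $x$, write $$G_T(x,y)=T\bigl[(1+xy)^n\bigr]=\sum_{\ell=-n}^{\rho}x^{\ell}P_\ell^n(xy),$$ where the $P_\ell^n$ are the (uniquely determined) polynomials of degree at most $n$ for which this holds; explicitly, the coefficient of $z^i$ in $P_\ell^n(z)$ is the coefficient of $x^{i+\ell}y^i$ in $G_T(x,y)$. A set $S\subseteq\mathbb{C}$ is called $T_n$-invariant if it is closed and, for every polynomial $p$ of degree exactly $n$ all of whose roots lie in $S$, the polynomial $T(p)$ is either $0$ or has all of its roots in $S$. **Theorem.** Suppose that $T$ is non-degenerate with $n$-th Fuchs index $\rho$, and let $g$ be a greatest common divisor of the polynomials $P_\ell^n$, $-n\le\ell\le\rho$. Then the closed disk $\bar D_R=\{x\in\mathbb{C}:|x|\le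 R\}$ is $T_n$-invariant for all sufficiently large $R>0$ if and only if both of the following hold: 1. all zeros of $g$ lie in $\{x:|x|\le 1\}$; 2. all zeros of $P_\rho^n/g$ lie in $\{x:|x|<1\}$. -/

import Mathlib

namespace FuchsDisk

open Polynomial

/-- `ℂ_n[x]`: the space of complex polynomials of degree at most `n`. -/
noncomputable abbrev PolyLE (n : ℕ) : Submodule ℂ ℂ[X] := Polynomial.degreeLE ℂ (n : WithBot ℕ)

/-- `T p` for a linear operator `T : ℂ_n[x] → ℂ[x]` and `p` of degree at most `n`. -/
noncomputable def app {n : ℕ} (T : PolyLE n →ₗ[ℂ] ℂ[X]) (p : ℂ[X])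
    (hp : p.degree ≤ (n : WithBot ℕ)) : ℂ[X] :=
  T ⟨p, Polynomial.mem_degreeLE.2 hp⟩

theorem degree_X_pow_le_of_fin {n : ℕ} (j : Fin (n + 1)) :
    ((X : ℂ[X]) ^ (j : ℕ)).degree ≤ (n : WithBot ℕ) := by
  rw [Polynomial.degree_X_pow]
  exact_mod_cast Nat.lt_succ_iff.1 j.2

/-- `T (x ^ j)`, for `0 ≤ j ≤ n`. -/
noncomputable def onMonomial {n : ℕ} (T : PolyLE n →ₗ[ℂ] ℂ[X]) (j : Fin (n + 1)) : ℂ[X] :=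
  app T (X ^ (j : ℕ)) (degree_X_pow_le_of_fin j)

/-- `deg T(x ^ j) - j`, where the zero polynomial has degree `-∞ = ⊥`. -/
noncomputable def degreeShift {n : ℕ} (T : PolyLE n →ₗ[ℂ] ℂ[X]) (j : Fin (n + 1)) :
    WithBot ℤ :=
  (onMonomial T j).degree.map (fun d : ℕ => (d : ℤ) - ((j : ℕ) : ℤ))

/-- The `n`-th Fuchs index `max_{0 ≤ j ≤ n} (deg T(x ^ j) - j)`.  It is an integer unless `T = 0`,
in which case it is `⊥`. -/
noncomputable def fuchsIndex {n : ℕ} (T : PolyLE n →ₗ[ℂ] ℂ[X]) : WithBot ℤ :=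
  Finset.univ.sup (degreeShift T)

/-- `T` is non-degenerate if its Fuchs index is attained at `x ^ n`. -/
def IsNondegenerate {n : ℕ} (T : PolyLE n →ₗ[ℂ] ℂ[X]) : Prop :=
  degreeShift T (Fin.last n) = fuchsIndex T

/-- A set `S ⊆ ℂ` is `T_n`-invariant if it is closed and, for every polynomial `p` of degree
exactly `n` with all roots in `S`, the polynomial `T p` is zero or has all its roots in `S`. -/
def IsInvariant {n : ℕ} (T : PolyLE n →ₗ[ℂ] ℂ[X]) (S : Set ℂ) : Prop :=
  IsClosed S ∧ ∀ (p : ℂ[X]) (hp : p.degree = (n : WithBot ℕ)), (∀ z, p.IsRoot z → z ∈ S) →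
    app T p hp.le = 0 ∨ ∀ z, (app T p hp.le).IsRoot z → z ∈ S

/-- The symbol `G_T(x, y) = T[(1 + x y) ^ n] = ∑ i, (n choose i) T(x ^ i) y ^ i`, with `T` acting
on the variable `x`, as a polynomial in `y` with coefficients in `ℂ[x]`.
See `symbol_eval_eq`. -/
noncomputable def symbol {n : ℕ} (T : PolyLE n →ₗ[ℂ] ℂ[X]) : Polynomial ℂ[X] :=
  ∑ i : Fin (n + 1), Polynomial.monomial (i : ℕ) ((n.choose (i : ℕ) : ℂ) • onMonomial T i)

/-- The polynomials `P_ℓ^n` in `G_T(x, y) = ∑_{-n ≤ ℓ ≤ ρ} x ^ ℓ P_ℓ^n(x y)`: the coefficient of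
`P_ℓ^n` at degree `i` is the coefficient of `x ^ (i + ℓ) y ^ i` in `G_T`.
See `symbol_eq_sum` and `symbolPart_natDegree_le`. -/
noncomputable def symbolPart {n : ℕ} (T : PolyLE n →ₗ[ℂ] ℂ[X]) (l : ℤ) : ℂ[X] :=
  ∑ i : Fin (n + 1), Polynomial.monomial (i : ℕ)
    (if 0 ≤ ((i : ℕ) : ℤ) + l then
      ((symbol T).coeff (i : ℕ)).coeff (((i : ℕ) : ℤ) + l).toNat else 0)

/-- `g` is a greatest common divisor of the family `(P l)_{l ∈ s}`. -/
def IsGCDOf (s : Finset ℤ) (P : ℤ → ℂ[X]) (g : ℂ[X]) : Prop :=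
  (∀ l ∈ s, g ∣ P l) ∧ ∀ d : ℂ[X], (∀ l ∈ s, d ∣ P l) → d ∣ g

theorem exists_isGCDOf (s : Finset ℤ) (P : ℤ → ℂ[X]) : ∃ g, IsGCDOf s P g := by
  classical
  induction s using Finset.induction_on with
  | empty => exact ⟨0, by simp, fun d _ => dvd_zero d⟩
  | insert a s _ ih =>
    obtain ⟨g, hg, hg'⟩ := ih
    refine ⟨EuclideanDomain.gcd (P a) g, ?_, ?_⟩
    · intro l hl
      rcases Finset.mem_insert.1 hl with rfl | h
      · exact EuclideanDomain.gcd_dvd_left _ _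
      · exact (EuclideanDomain.gcd_dvd_right _ _).trans (hg l h)
    · intro d hd
      exact EuclideanDomain.dvd_gcd (hd a (Finset.mem_insert_self _ _))
        (hg' d fun l hl => hd l (Finset.mem_insert_of_mem hl))

theorem degree_one_add_pow_le (n : ℕ) (y : ℂ) :
    ((1 + C y * X : ℂ[X]) ^ n).degree ≤ (n : WithBot ℕ) := by
  refine (Polynomial.degree_pow_le _ _).trans ?_
  have h : (1 + C y * X : ℂ[X]).degree ≤ 1 := by
    rw [add_comm, ← C_1]
    exact Polynomial.degree_linear_le
  calc n • (1 + C y * X : ℂ[X]).degree ≤ n • (1 : WithBot ℕ) := nsmul_le_nsmul_right h n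
    _ = (n : WithBot ℕ) := by simp

theorem symbol_eval_eq {n : ℕ} (T : PolyLE n →ₗ[ℂ] ℂ[X]) (y : ℂ) :
    (symbol T).eval (C y) = app T ((1 + C y * X) ^ n) (degree_one_add_pow_le n y) := by
  have h : (⟨(1 + C y * X) ^ n, Polynomial.mem_degreeLE.2 (degree_one_add_pow_le n y)⟩ : PolyLE n)
      = ∑ i : Fin (n + 1), (y ^ (i : ℕ) * (n.choose (i : ℕ) : ℂ)) •
        (⟨X ^ (i : ℕ), Polynomial.mem_degreeLE.2 (degree_X_pow_le_of_fin i)⟩ : PolyLE n) := by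
    apply Subtype.ext
    simp only [AddSubmonoidClass.coe_finsetSum, SetLike.val_smul]
    rw [add_comm, add_pow, Finset.sum_range]
    refine Finset.sum_congr rfl fun i _ => ?_
    rw [Polynomial.smul_eq_C_mul, mul_pow]
    simp only [one_pow, map_mul, map_pow, map_natCast]
    ring
  unfold app symbol
  rw [h, map_sum, Polynomial.eval_finsetSum]
  refine Finset.sum_congr rfl fun i _ => ?_
  rw [LinearMap.map_smul T, Polynomial.eval_monomial, onMonomial, app, Polynomial.smul_eq_C_mul,
    Polynomial.smul_eq_C_mul]
  simp only [map_mul, map_pow]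
  ring

theorem symbolPart_natDegree_le {n : ℕ} (T : PolyLE n →ₗ[ℂ] ℂ[X]) (l : ℤ) :
    (symbolPart T l).natDegree ≤ n := by
  refine Polynomial.natDegree_sum_le_of_forall_le _ _ fun i _ => ?_
  exact (Polynomial.natDegree_monomial_le _).trans (Nat.lt_succ_iff.1 i.2)

theorem symbol_coeff {n : ℕ} (T : PolyLE n →ₗ[ℂ] ℂ[X]) (i : Fin (n + 1)) :
    (symbol T).coeff (i : ℕ) = (n.choose (i : ℕ) : ℂ) • onMonomial T i := by
  rw [symbol, Polynomial.finsetSum_coeff, Finset.sum_eq_single i]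
  · simp
  · intro j _ hj
    rw [Polynomial.coeff_monomial, if_neg (fun h => hj (Fin.ext h))]
  · simp

theorem natDegree_le_of_fuchsIndex {n : ℕ} (T : PolyLE n →ₗ[ℂ] ℂ[X]) {r : ℤ}
    (hr : fuchsIndex T = r) (i : Fin (n + 1)) (h0 : onMonomial T i ≠ 0) :
    ((onMonomial T i).natDegree : ℤ) ≤ r + ((i : ℕ) : ℤ) := by
  have h : degreeShift T i ≤ fuchsIndex T := Finset.le_sup (Finset.mem_univ i)
  rw [hr, degreeShift, Polynomial.degree_eq_natDegree h0] at h
  have h' : ((((onMonomial T i).natDegree : ℤ) - ((i : ℕ) : ℤ) : ℤ) : WithBot ℤ) ≤ r := h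
  have := WithBot.coe_le_coe.1 h'
  omega

/-- The decomposition `G_T(x, y) = ∑_{-n ≤ ℓ ≤ ρ} x ^ ℓ P_ℓ^n(x y)`. -/
theorem symbol_eq_sum {n : ℕ} (T : PolyLE n →ₗ[ℂ] ℂ[X]) {r : ℤ}
    (hr : fuchsIndex T = r) (x y : ℂ) (hx : x ≠ 0) :
    ((symbol T).eval (C y)).eval x =
      ∑ l ∈ Finset.Icc (-(n : ℤ)) r, x ^ l * (symbolPart T l).eval (x * y) := by
  have hL : ((symbol T).eval (C y)).eval x =
      ∑ i : Fin (n + 1), ((symbol T).coeff (i : ℕ)).eval x * y ^ (i : ℕ) := by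
    conv_lhs => rw [symbol]
    rw [Polynomial.eval_finsetSum, Polynomial.eval_finsetSum]
    refine Finset.sum_congr rfl fun i _ => ?_
    rw [symbol_coeff, Polynomial.eval_monomial, Polynomial.eval_mul, Polynomial.eval_pow,
      Polynomial.eval_C]
  rw [hL]
  simp only [symbolPart, Polynomial.eval_finsetSum, Finset.mul_sum]
  rw [Finset.sum_comm]
  refine Finset.sum_congr rfl fun i _ => ?_
  simp only [Polynomial.eval_monomial]
  have hi : (i : ℕ) ≤ n := Nat.lt_succ_iff.1 i.2
  rw [Polynomial.eval_eq_sum, Polynomial.sum, Finset.sum_mul]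
  symm
  refine Finset.sum_bij_ne_zero (fun l _ _ => (((i : ℕ) : ℤ) + l).toNat) ?_ ?_ ?_ ?_
  · intro l _ h
    rw [Polynomial.mem_support_iff]
    intro h0
    apply h
    rw [h0]
    simp
  · intro l _ h l' _ h' e
    have a : 0 ≤ ((i : ℕ) : ℤ) + l := by
      by_contra hc
      exact h (by rw [if_neg hc]; simp)
    have a' : 0 ≤ ((i : ℕ) : ℤ) + l' := by
      by_contra hc
      exact h' (by rw [if_neg hc]; simp)
    omega
  · intro m hm hne
    have hmc := Polynomial.mem_support_iff.1 hm
    have e : (((i : ℕ) : ℤ) + ((m : ℤ) - ((i : ℕ) : ℤ))) = (m : ℤ) := by ring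
    have hT0 : onMonomial T i ≠ 0 := by
      intro h0
      rw [symbol_coeff, h0] at hmc
      simp at hmc
    have hm2 : m ≤ (onMonomial T i).natDegree := by
      apply Polynomial.le_natDegree_of_ne_zero
      intro h0
      rw [symbol_coeff, Polynomial.coeff_smul, h0] at hmc
      simp at hmc
    have hb := natDegree_le_of_fuchsIndex T hr i hT0
    have hval : x ^ ((m : ℤ) - ((i : ℕ) : ℤ)) * ((if 0 ≤ (((i : ℕ) : ℤ) +
        ((m : ℤ) - ((i : ℕ) : ℤ))) then ((symbol T).coeff (i : ℕ)).coeff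
        (((i : ℕ) : ℤ) + ((m : ℤ) - ((i : ℕ) : ℤ))).toNat else 0) * (x * y) ^ (i : ℕ)) =
        ((symbol T).coeff (i : ℕ)).coeff m * x ^ m * y ^ (i : ℕ) := by
      rw [e, if_pos (by positivity), Int.toNat_natCast, zpow_sub₀ hx, mul_pow, zpow_natCast,
        zpow_natCast]
      field_simp
    refine ⟨(m : ℤ) - ((i : ℕ) : ℤ), ?_, ?_, ?_⟩
    · rw [Finset.mem_Icc]
      constructor <;> omega
    · rw [hval]
      exact hne
    · rw [e]
      simp
  · intro l _ h
    have a : 0 ≤ ((i : ℕ) : ℤ) + l := by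
      by_contra hc
      exact h (by rw [if_neg hc]; simp)
    obtain ⟨m, hm⟩ := Int.eq_ofNat_of_zero_le a
    have hl : l = (m : ℤ) - ((i : ℕ) : ℤ) := by omega
    rw [if_pos a, hm, hl, Int.toNat_natCast, zpow_sub₀ hx, mul_pow, zpow_natCast, zpow_natCast]
    field_simp

end FuchsDisk

/-!
Write `F(x, w) = T[(X - w) ^ n](x)`. For `x, w ≠ 0` and `u = -x / w` the symbol gives
`F(x, w) = (-w) ^ n * ∑ x ^ l * P_l(u)`, and `|w| ≤ R < |x|` forces `|u| > 1`.

Grace's theorem (`functional_ne_zero_of_roots_mem_disk`), applied to the functional `p ↦ T(p)(x)`,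
shows that the disk of radius `R` is invariant as soon as `F(x, w) ≠ 0` for `|w| ≤ R < |x|`.
Conversely the polynomials `(X - w) ^ n` are themselves test polynomials, and non-degeneracy
prevents `T` from killing them. Invariance of all large disks therefore amounts to
`∑ x ^ l * P_l(u) ≠ 0` for `|x|` large and `|u| > 1`
(`sum_symbolPart_ne_zero_of_isInvariant`, `isInvariant_closedBall_of_sum_symbolPart_ne_zero`).

With `P_l = g * Q_l` this sum is `g(u) * ∑ x ^ l * Q_l(u)`, so `g` must have no zero in `|u| > 1`.
Non-degeneracy gives `deg Q_l ≤ deg Q_ρ`. If `Q_ρ` has no zero in `|u| ≥ 1`, the quotients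
`Q_l / Q_ρ` are bounded there, and the term `l = ρ` dominates for `|x|` large
(`exists_sum_zpow_mul_ne_zero`). Conversely, put `t = 1 / x` and consider the polynomial
`∑ t ^ (ρ - l) * Q_l(u)`, which has no zero with `0 < |t| < ε`, `|u| > 1`. By Hurwitz's theorem
in `u`, as `t → 0`, its value `Q_ρ(u)` at `t = 0` has no zero in `|u| > 1`; then, by Hurwitz's theorem
in `t`, as `u` tends to a zero `u₀` of `Q_ρ` on the unit circle, the polynomial
`∑ t ^ (ρ - l) * Q_l(u₀)` in `t` vanishes identically, so that all `Q_l` vanish at `u₀`. This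
contradicts the choice of `g` (`norm_root_lt_one_of_sum_zpow_mul_ne_zero`).
-/

namespace FuchsDisk

open Polynomial Filter Topology

/-! ### Grace's theorem for a closed disk -/

/-- The inversion `ζ ↦ (ζ - w)⁻¹` about a point `w` of the closed disk of radius `R` maps the
exterior of the disk, together with `∞`, onto this set. -/
theorem convex_inversion_exterior {R : ℝ} {w : ℂ} (hw : ‖w‖ ≤ R) :
    Convex ℝ {s : ℂ | R * ‖s‖ < ‖1 + w * s‖} := by
  have hc : 0 ≤ R ^ 2 - ‖w‖ ^ 2 := by nlinarith [norm_nonneg w]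
  have h1 : ConvexOn ℝ Set.univ (fun s : ℂ => (R ^ 2 - ‖w‖ ^ 2) • ‖s‖ ^ 2) :=
    ((convexOn_norm convex_univ).pow (fun _ _ => norm_nonneg _) 2).smul hc
  have h2 : ConvexOn ℝ Set.univ (fun s : ℂ => -2 * (w * s).re) := by
    refine ⟨convex_univ, fun x _ y _ a b _ _ _ => le_of_eq ?_⟩
    simp only [Complex.mul_re, Complex.add_re, Complex.add_im, Complex.smul_re, Complex.smul_im,
      smul_eq_mul]
    ring
  suffices e : {s : ℂ | R * ‖s‖ < ‖1 + w * s‖} = _ from e ▸ (h1.add h2).convex_lt 1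
  ext s
  have hR : 0 ≤ R := (norm_nonneg w).trans hw
  have key : ‖1 + w * s‖ ^ 2 = 1 + 2 * (w * s).re + ‖w‖ ^ 2 * ‖s‖ ^ 2 := by
    simp only [← Complex.normSq_eq_norm_sq, Complex.normSq_apply, Complex.mul_re, Complex.mul_im,
      Complex.add_re, Complex.add_im, Complex.one_re, Complex.one_im]
    ring
  simp only [Set.mem_ofPred_eq, Set.mem_univ, true_and, Pi.add_apply, smul_eq_mul]
  rw [← sq_lt_sq₀ (by positivity) (norm_nonneg _), key, mul_pow]
  constructor <;> intro h <;> linarith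

theorem Convex.multiset_average_mem {S : Set ℂ} (hS : Convex ℝ S) (s : Multiset ℂ) (hs : s ≠ 0)
    (h : ∀ z ∈ s, z ∈ S) : s.sum / (Multiset.card s : ℂ) ∈ S := by
  classical
  have hcard : (Multiset.card s : ℝ) ≠ 0 := by simpa using hs
  have hw : ∑ z ∈ s.toFinset, (s.count z : ℝ) / Multiset.card s = 1 := by
    rw [← Finset.sum_div, ← Nat.cast_sum, Multiset.toFinset_sum_count_eq, div_self hcard]
  have := hS.sum_mem (t := s.toFinset) (w := fun z => (s.count z : ℝ) / Multiset.card s)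
    (z := fun z => z) (fun _ _ => by positivity) hw (fun z hz => h z (Multiset.mem_toFinset.1 hz))
  convert this using 1
  rw [Finset.sum_multiset_count, Finset.sum_div]
  refine Finset.sum_congr rfl fun z _ => ?_
  simp only [Complex.real_smul, nsmul_eq_mul, Complex.ofReal_div, Complex.ofReal_natCast]
  ring

/-- Laguerre's theorem on polar derivatives, in the form of one step of Grace's theorem: one of
the `m + 1` coinciding nodes may be moved within the disk. -/
theorem functional_ne_zero_move_node (M : ℂ[X] →ₗ[ℂ] ℂ) (m : ℕ) {R : ℝ}
    (h : ∀ w : ℂ, ‖w‖ ≤ R → M ((X - C w) ^ (m + 1)) ≠ 0) {w v : ℂ} (hw : ‖w‖ ≤ R)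
    (hv : ‖v‖ ≤ R) : M ((X - C w) ^ m * (X - C v)) ≠ 0 := by
  intro h0
  set a : ℕ → ℂ := fun k => M ((X - C w) ^ k) with ha
  have ha1 : a (m + 1) ≠ 0 := h w hw
  have hrel : a (m + 1) = (v - w) * a m := by
    have e : (X - C w) ^ m * (X - C v) = (X - C w) ^ (m + 1) - (v - w) • (X - C w) ^ m := by
      rw [smul_eq_C_mul, C_sub]; ring
    rw [e, map_sub, map_smul, smul_eq_mul, sub_eq_zero] at h0
    exact h0
  have hvw : v - w ≠ 0 := by
    intro h1
    rw [h1, zero_mul] at hrel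
    exact ha1 hrel
  -- The roots of `r` are the values `(ζ - w)⁻¹` at the zeros `ζ` of `z ↦ M ((X - z) ^ (m + 1))`;
  -- zeros at infinity give the root `0`, so that `r` has exactly `m + 1` roots.
  set r : ℂ[X] := ∑ k ∈ Finset.range (m + 2),
    C (((m + 1).choose k : ℂ) * a k * (-1) ^ (m + 1 - k)) * X ^ k with hr
  have hcoeff : ∀ j < m + 2, r.coeff j = ((m + 1).choose j : ℂ) * a j * (-1) ^ (m + 1 - j) := by
    intro j hj
    simp only [hr, finsetSum_coeff, coeff_C_mul_X_pow]
    rw [Finset.sum_ite_eq, if_pos (Finset.mem_range.2 hj)]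
  have hroot : ∀ s, r.eval s = M ((C s * (X - C w) - 1) ^ (m + 1)) := by
    intro s
    rw [sub_eq_add_neg, add_pow, map_sum, hr, eval_finsetSum]
    refine Finset.sum_congr rfl fun k _ => ?_
    have e : (C s * (X - C w)) ^ k * (-1) ^ (m + 1 - k) * (((m + 1).choose k : ℕ) : ℂ[X]) =
        (s ^ k * (-1) ^ (m + 1 - k) * ((m + 1).choose k : ℂ)) • (X - C w) ^ k := by
      rw [smul_eq_C_mul, mul_pow]
      simp only [map_mul, map_pow, map_neg, map_one, map_natCast]
      ring
    rw [e, map_smul, smul_eq_mul, eval_mul, eval_C, eval_pow, eval_X]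
    ring
  have hdeg : r.natDegree = m + 1 := by
    refine natDegree_eq_of_le_of_coeff_ne_zero ?_ ?_
    · refine natDegree_sum_le_of_forall_le _ _ fun k hk => ?_
      exact (natDegree_C_mul_X_pow_le _ _).trans (by have := Finset.mem_range.1 hk; omega)
    · rw [hcoeff _ (by omega)]; simpa using ha1
  have hsp : r.Splits := IsAlgClosed.splits r
  have hcard : Multiset.card r.roots = m + 1 := by rw [← hsp.natDegree_eq_card_roots, hdeg]
  have hsum : r.roots.sum / (Multiset.card r.roots : ℂ) = 1 / (v - w) := by
    have h1 := hsp.nextCoeff_eq_neg_sum_roots_mul_leadingCoeff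
    rw [nextCoeff_of_natDegree_pos (by omega), leadingCoeff, hdeg, Nat.add_sub_cancel,
      hcoeff _ (by omega), hcoeff _ (by omega)] at h1
    have hm : ((m : ℂ) + 1) ≠ 0 := by exact_mod_cast Nat.succ_ne_zero m
    have ham : a m ≠ 0 := by
      intro h2; rw [h2, mul_zero] at hrel; exact ha1 hrel
    simp [hrel] at h1
    have h2 : ((m : ℂ) + 1) = (v - w) * r.roots.sum := by
      apply mul_right_cancel₀ ham
      linear_combination h1
    rw [hcard, div_eq_div_iff (by exact_mod_cast Nat.succ_ne_zero m) hvw]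
    push_cast
    linear_combination -h2
  have hmem : ∀ s ∈ r.roots, s ∈ {s : ℂ | R * ‖s‖ < ‖1 + w * s‖} := by
    intro s hs
    have h1 : r.eval s = 0 := (mem_roots'.1 hs).2
    rw [hroot] at h1
    rcases eq_or_ne s 0 with rfl | hs0
    · simp
    have e : (C s * (X - C w) - 1) ^ (m + 1) = s ^ (m + 1) • (X - C (w + s⁻¹)) ^ (m + 1) := by
      rw [smul_eq_C_mul, C_pow, ← mul_pow]
      congr 1
      have : C s * C s⁻¹ = (1 : ℂ[X]) := by rw [← C_mul, mul_inv_cancel₀ hs0, C_1]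
      rw [C_add]
      linear_combination this
    rw [e, map_smul, smul_eq_mul] at h1
    have h2 : R < ‖w + s⁻¹‖ := by
      by_contra hc
      exact (mul_ne_zero (pow_ne_zero _ hs0) (h _ (not_lt.1 hc))) h1
    have h3 : 1 + w * s = (w + s⁻¹) * s := by field_simp; ring
    rw [Set.mem_ofPred_eq, h3, norm_mul]
    exact mul_lt_mul_of_pos_right h2 (norm_pos_iff.2 hs0)
  have hne : r.roots ≠ 0 := by
    rw [← Multiset.card_pos, hcard]; omega
  have hfin := Convex.multiset_average_mem (convex_inversion_exterior hw) r.roots hne hmem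
  rw [hsum, Set.mem_ofPred_eq] at hfin
  have h3 : 1 + w * (1 / (v - w)) = v * (1 / (v - w)) := by field_simp; ring
  rw [h3, norm_mul] at hfin
  exact absurd (lt_of_mul_lt_mul_right hfin (norm_nonneg _)) (not_lt.2 hv)

theorem functional_prod_ne_zero {R : ℝ} (s : Multiset ℂ) (hs : ∀ z ∈ s, ‖z‖ ≤ R)
    (M : ℂ[X] →ₗ[ℂ] ℂ) (h : ∀ w : ℂ, ‖w‖ ≤ R → M ((X - C w) ^ Multiset.card s) ≠ 0)
    (hR : 0 ≤ R) : M (s.map fun z => X - C z).prod ≠ 0 := by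
  induction s using Multiset.induction_on generalizing M with
  | empty => simpa using h 0 (by simpa using hR)
  | cons v s ih =>
    have := ih (fun z hz => hs z (Multiset.mem_cons_of_mem hz))
      (M ∘ₗ LinearMap.mulRight ℂ (X - C v)) (fun w hw => by
        rw [Multiset.card_cons] at h
        exact functional_ne_zero_move_node M _ h hw (hs v (Multiset.mem_cons_self v s)))
    rw [LinearMap.comp_apply, LinearMap.mulRight_apply] at this
    rwa [Multiset.map_cons, Multiset.prod_cons, mul_comm]

/-- **Grace's theorem** for a closed disk: a linear functional that does not vanish on the powers
`(X - w) ^ n` with `w` in the disk does not vanish on any polynomial of degree `n` with all roots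
in the disk. -/
theorem functional_ne_zero_of_roots_mem_disk {R : ℝ} (hR : 0 ≤ R) (M : ℂ[X] →ₗ[ℂ] ℂ) {p : ℂ[X]}
    (hp0 : p ≠ 0) (hp : ∀ z, p.IsRoot z → ‖z‖ ≤ R)
    (h : ∀ w : ℂ, ‖w‖ ≤ R → M ((X - C w) ^ p.natDegree) ≠ 0) : M p ≠ 0 := by
  have hsp : p.Splits := IsAlgClosed.splits p
  rw [hsp.eq_prod_roots, ← smul_eq_C_mul, map_smul, smul_eq_mul]
  refine mul_ne_zero (leadingCoeff_ne_zero.2 hp0) (functional_prod_ne_zero _ ?_ M ?_ hR)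
  · exact fun z hz => hp z (mem_roots'.1 hz).2
  · rwa [← hsp.natDegree_eq_card_roots]

/-! ### Zeros of limits of polynomials -/

/-- A polynomial without zeros in `B(c, ε)` is controlled by its value at the centre `c`. -/
theorem norm_eval_le_of_no_root_mem_ball {f : ℂ[X]} {c : ℂ} {ε : ℝ} (hε : 0 < ε)
    (hf : ∀ z ∈ Metric.ball c ε, ¬ f.IsRoot z) (z : ℂ) :
    ‖f.eval z‖ ≤ ‖f.eval c‖ * (1 + ‖z - c‖ / ε) ^ f.natDegree := by
  have hsp : f.Splits := IsAlgClosed.splits f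
  have h1 := hsp.eval_eq_prod_roots z
  have h2 := hsp.eval_eq_prod_roots c
  rw [h1, h2, hsp.natDegree_eq_card_roots, norm_mul, norm_mul, mul_assoc]
  refine mul_le_mul_of_nonneg_left ?_ (norm_nonneg _)
  have key : ∀ s : Multiset ℂ, (∀ a ∈ s, ε ≤ ‖c - a‖) →
      ‖(s.map fun a => z - a).prod‖ ≤
        ‖(s.map fun a => c - a).prod‖ * (1 + ‖z - c‖ / ε) ^ Multiset.card s := by
    intro s
    induction s using Multiset.induction_on with
    | empty => simp
    | cons a s ih =>
      intro hs
      have ih := ih fun b hb => hs b (Multiset.mem_cons_of_mem hb)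
      have ha := hs a (Multiset.mem_cons_self a s)
      have hstep : ‖z - a‖ ≤ ‖c - a‖ * (1 + ‖z - c‖ / ε) := by
        have e1 : ‖z - a‖ ≤ ‖z - c‖ + ‖c - a‖ := norm_sub_le_norm_sub_add_norm_sub z c a
        have e2 : ‖z - c‖ ≤ ‖c - a‖ * (‖z - c‖ / ε) := by
          rw [mul_div_assoc', le_div_iff₀ hε, mul_comm]
          exact mul_le_mul_of_nonneg_right ha (norm_nonneg _)
        linarith
      simp only [Multiset.map_cons, Multiset.prod_cons, norm_mul, Multiset.card_cons, pow_succ]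
      calc ‖z - a‖ * ‖(s.map fun a => z - a).prod‖
          ≤ (‖c - a‖ * (1 + ‖z - c‖ / ε)) *
            (‖(s.map fun a => c - a).prod‖ * (1 + ‖z - c‖ / ε) ^ Multiset.card s) := by
            gcongr
        _ = _ := by ring
  refine key f.roots fun a ha => ?_
  by_contra hc
  refine hf a ?_ (mem_roots'.1 ha).2
  rw [Metric.mem_ball, dist_comm, dist_eq_norm]
  exact not_le.1 hc

/-- Hurwitz's theorem for polynomials of bounded degree: if `f i → f₀` pointwise, the `f i` have no
zeros in `B(c, ε)` and `f₀ c = 0`, then `f₀` vanishes identically. -/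
theorem eval_eq_zero_of_tendsto {ι : Type*} {l : Filter ι} [l.NeBot] {f : ι → ℂ[X]} {f₀ : ℂ[X]}
    {c : ℂ} {ε : ℝ} (hε : 0 < ε) {N : ℕ} (hN : ∀ i, (f i).natDegree ≤ N)
    (hf : ∀ᶠ i in l, ∀ z ∈ Metric.ball c ε, ¬ (f i).IsRoot z)
    (hlim : ∀ z, Tendsto (fun i => (f i).eval z) l (𝓝 (f₀.eval z))) (hc : f₀.eval c = 0) (z : ℂ) :
    f₀.eval z = 0 := by
  have h1 : ∀ᶠ i in l, ‖(f i).eval z‖ ≤ ‖(f i).eval c‖ * (1 + ‖z - c‖ / ε) ^ N := by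
    filter_upwards [hf] with i hi
    refine (norm_eval_le_of_no_root_mem_ball hε hi z).trans ?_
    refine mul_le_mul_of_nonneg_left (pow_le_pow_right₀ ?_ (hN i)) (norm_nonneg _)
    have : 0 ≤ ‖z - c‖ / ε := by positivity
    linarith
  have h2 := le_of_tendsto_of_tendsto (hlim z).norm ((hlim c).norm.mul_const _) h1
  rw [hc, norm_zero, zero_mul] at h2
  exact norm_le_zero_iff.1 h2

/-! ### Bounds outside the open unit disk -/

theorem norm_eval_le_mul_pow {Q : ℂ[X]} {d : ℕ} (hd : Q.natDegree ≤ d) {u : ℂ} (hu : 1 ≤ ‖u‖) :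
    ‖Q.eval u‖ ≤ (∑ i ∈ Finset.range (d + 1), ‖Q.coeff i‖) * ‖u‖ ^ d := by
  rw [eval_eq_sum_range' (Nat.lt_succ_iff.2 hd), Finset.sum_mul]
  refine (norm_sum_le _ _).trans (Finset.sum_le_sum fun i hi => ?_)
  rw [norm_mul, norm_pow]
  exact mul_le_mul_of_nonneg_left
    (pow_le_pow_right₀ hu (Nat.lt_succ_iff.1 (Finset.mem_range.1 hi))) (norm_nonneg _)

theorem exists_mul_pow_le_norm_eval {Q : ℂ[X]} (hQ0 : Q ≠ 0) (hQ : ∀ z, Q.IsRoot z → ‖z‖ < 1) :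
    ∃ δ : ℝ, 0 < δ ∧ ∀ u : ℂ, 1 ≤ ‖u‖ → δ * ‖u‖ ^ Q.natDegree ≤ ‖Q.eval u‖ := by
  -- The reversed polynomial has no zero on the closed unit disk, which is compact.
  obtain ⟨v₀, hv₀, hmin⟩ := (isCompact_closedBall (0 : ℂ) 1).exists_isMinOn
    ⟨0, by simp⟩ (f := fun v => ‖Q.reverse.eval v‖) (by fun_prop)
  have key : ∀ u : ℂ, u ≠ 0 → Q.reverse.eval u⁻¹ * u ^ Q.natDegree = Q.eval u := by
    intro u hu
    let _ := invertibleOfNonzero hu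
    have := eval₂_reverse_mul_pow (RingHom.id ℂ) u Q
    rwa [invOf_eq_inv] at this
  refine ⟨‖Q.reverse.eval v₀‖, norm_pos_iff.2 fun h0 => ?_, fun u hu => ?_⟩
  · rcases eq_or_ne v₀ 0 with rfl | hne
    · rw [← coeff_zero_eq_eval_zero, coeff_zero_reverse, leadingCoeff_eq_zero] at h0
      exact hQ0 h0
    · have h1 := key v₀⁻¹ (inv_ne_zero hne)
      rw [inv_inv, h0, zero_mul] at h1
      have h2 := hQ _ h1.symm
      rw [norm_inv] at h2
      have h3 : ‖v₀‖ ≤ 1 := by simpa using hv₀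
      exact absurd h2 (not_lt.2 ((one_le_inv₀ (norm_pos_iff.2 hne)).2 h3))
  · have hu0 : u ≠ 0 := norm_pos_iff.1 (one_pos.trans_le hu)
    rw [← key u hu0, norm_mul, norm_pow]
    refine mul_le_mul_of_nonneg_right (isMinOn_iff.1 hmin u⁻¹ ?_) (by positivity)
    simpa using inv_le_one_of_one_le₀ hu

/-! ### Families of polynomials weighted by powers of a second variable -/

theorem exists_sum_zpow_mul_ne_zero {s : Finset ℤ} {ρ : ℤ} (hρs : ρ ∈ s) (hs : ∀ l ∈ s, l ≤ ρ)
    {Q : ℤ → ℂ[X]} (hQ0 : Q ρ ≠ 0) (hdeg : ∀ l ∈ s, (Q l).natDegree ≤ (Q ρ).natDegree)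
    (hQ : ∀ z, (Q ρ).IsRoot z → ‖z‖ < 1) :
    ∃ R₀ : ℝ, 0 < R₀ ∧ ∀ x u : ℂ, R₀ < ‖x‖ → 1 ≤ ‖u‖ →
      ∑ l ∈ s, x ^ l * (Q l).eval u ≠ 0 := by
  classical
  obtain ⟨δ, hδ, hlow⟩ := exists_mul_pow_le_norm_eval hQ0 hQ
  set d := (Q ρ).natDegree
  set B : ℝ := ∑ l ∈ s.erase ρ, ∑ i ∈ Finset.range (d + 1), ‖(Q l).coeff i‖ with hB
  refine ⟨max 1 (B / δ), by positivity, fun x u hx hu h0 => ?_⟩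
  have hx1 : 1 < ‖x‖ := (le_max_left _ _).trans_lt hx
  have hxB : B < ‖x‖ * δ := (div_lt_iff₀ hδ).1 ((le_max_right _ _).trans_lt hx)
  have hx0 : 0 < ‖x‖ := one_pos.trans hx1
  have hupper : ‖∑ l ∈ s.erase ρ, x ^ l * (Q l).eval u‖ ≤ ‖x‖ ^ (ρ - 1) * (B * ‖u‖ ^ d) := by
    rw [hB, Finset.sum_mul, Finset.mul_sum]
    refine (norm_sum_le _ _).trans (Finset.sum_le_sum fun l hl => ?_)
    have hl' := Finset.mem_erase.1 hl
    rw [norm_mul, norm_zpow]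
    refine mul_le_mul (zpow_le_zpow_right₀ hx1.le ?_) (norm_eval_le_mul_pow (hdeg l hl'.2) hu)
      (norm_nonneg _) (by positivity)
    have := hs l hl'.2
    have := hl'.1
    omega
  rw [← Finset.add_sum_erase s _ hρs, add_eq_zero_iff_eq_neg] at h0
  have h1 : ‖x‖ ^ ρ * (δ * ‖u‖ ^ d) ≤ ‖x‖ ^ (ρ - 1) * (B * ‖u‖ ^ d) := by
    refine le_trans ?_ hupper
    rw [← norm_neg (∑ l ∈ s.erase ρ, _), ← h0, norm_mul, norm_zpow]
    exact mul_le_mul_of_nonneg_left (hlow u hu) (by positivity)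
  have h2 : ‖x‖ ^ ρ = ‖x‖ ^ (ρ - 1) * ‖x‖ := by
    rw [← zpow_add_one₀ hx0.ne', sub_add_cancel]
  have hu' : 0 < ‖u‖ ^ d := pow_pos (one_pos.trans_le hu) d
  have h3 : ‖x‖ ^ (ρ - 1) * (B * ‖u‖ ^ d) < ‖x‖ ^ ρ * (δ * ‖u‖ ^ d) := by
    rw [h2, mul_assoc, ← mul_assoc ‖x‖ δ]
    exact mul_lt_mul_of_pos_left (mul_lt_mul_of_pos_right hxB hu') (by positivity)
  exact absurd h1 (not_le.2 h3)

/-- With `t = x⁻¹`, the sum `∑ t ^ (ρ - l) Q_l(u)` is a polynomial in both variables and equals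
`Q_ρ(u)` at `t = 0`. A zero of `Q_ρ` outside the closed disk persists for small `t ≠ 0`; one on the
unit circle is excluded by viewing the sum as a polynomial in `t` and letting `u` tend to that zero
from outside the disk. -/
theorem norm_root_lt_one_of_sum_zpow_mul_ne_zero {s : Finset ℤ} {ρ : ℤ} (hρs : ρ ∈ s)
    (hs : ∀ l ∈ s, l ≤ ρ) {Q : ℤ → ℂ[X]} (hQ0 : Q ρ ≠ 0) {R₀ : ℝ} (hR₀ : 0 < R₀)
    (h : ∀ x u : ℂ, R₀ < ‖x‖ → 1 < ‖u‖ → ∑ l ∈ s, x ^ l * (Q l).eval u ≠ 0)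
    (hcop : ∀ z, ∃ l ∈ s, ¬ (Q l).IsRoot z) {u₀ : ℂ} (hu₀ : (Q ρ).IsRoot u₀) : ‖u₀‖ < 1 := by
  have hK0 : ∀ u, ∑ l ∈ s, (0 : ℂ) ^ (ρ - l).toNat * (Q l).eval u = (Q ρ).eval u := by
    intro u
    rw [Finset.sum_eq_single_of_mem ρ hρs]
    · simp
    · intro l hl hne
      have := hs l hl
      rw [zero_pow (by omega), zero_mul]
  have hK : ∀ t u : ℂ, t ≠ 0 → ‖t‖ < R₀⁻¹ → 1 < ‖u‖ →
      ∑ l ∈ s, t ^ (ρ - l).toNat * (Q l).eval u ≠ 0 := by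
    intro t u ht0 ht hu
    have e : ∑ l ∈ s, t ^ (ρ - l).toNat * (Q l).eval u =
        t ^ ρ * ∑ l ∈ s, t⁻¹ ^ l * (Q l).eval u := by
      rw [Finset.mul_sum]
      refine Finset.sum_congr rfl fun l hl => ?_
      have h1 : t ^ (ρ - l).toNat = t ^ ρ * t⁻¹ ^ l := by
        rw [← zpow_natCast, Int.toNat_of_nonneg (sub_nonneg.2 (hs l hl)), zpow_sub₀ ht0,
          inv_zpow, div_eq_mul_inv]
      rw [h1, mul_assoc]
    rw [e]
    refine mul_ne_zero (zpow_ne_zero _ ht0) (h _ _ ?_ hu)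
    rw [norm_inv]
    exact (lt_inv_comm₀ (norm_pos_iff.2 ht0) hR₀).1 ht
  have hle : ∀ u, (Q ρ).IsRoot u → ‖u‖ ≤ 1 := by
    intro u hu
    by_contra hc
    rw [not_le] at hc
    apply hQ0
    refine Polynomial.funext fun z => ?_
    rw [eval_zero]
    have hev : ∀ (t z : ℂ), (∑ l ∈ s, C (t ^ (ρ - l).toNat) * Q l).eval z =
        ∑ l ∈ s, t ^ (ρ - l).toNat * (Q l).eval z := by
      intro t z
      simp only [eval_finsetSum, eval_mul, eval_C]
    refine eval_eq_zero_of_tendsto (l := 𝓝[≠] (0 : ℂ))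
      (f := fun t => ∑ l ∈ s, C (t ^ (ρ - l).toNat) * Q l) (sub_pos.2 hc)
      (N := s.sup fun l => (Q l).natDegree) ?_ ?_ ?_ hu z
    · intro t
      refine natDegree_sum_le_of_forall_le _ _ fun l hl => ?_
      exact (natDegree_C_mul_le _ _).trans (Finset.le_sup (f := fun l => (Q l).natDegree) hl)
    · have hsmall : ∀ᶠ t : ℂ in 𝓝[≠] 0, ‖t‖ < R₀⁻¹ :=
        nhdsWithin_le_nhds ((continuous_norm.tendsto' (0 : ℂ) 0 norm_zero).eventually_lt_const
          (inv_pos.2 hR₀))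
      filter_upwards [hsmall, self_mem_nhdsWithin] with t ht ht0 v hv
      rw [IsRoot.def, hev]
      refine hK t v ht0 ht ?_
      rw [Metric.mem_ball, dist_comm, dist_eq_norm] at hv
      have := norm_sub_norm_le u v
      linarith
    · intro v
      simp only [hev]
      have hcont : Continuous fun t : ℂ => ∑ l ∈ s, t ^ (ρ - l).toNat * (Q l).eval v := by
        fun_prop
      rw [← hK0 v]
      exact (hcont.tendsto 0).mono_left nhdsWithin_le_nhds
  refine (hle u₀ hu₀).lt_of_ne fun hone => ?_
  obtain ⟨k, hk, hne⟩ := hcop u₀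
  apply hne
  have hev : ∀ (u t : ℂ), (∑ l ∈ s, C ((Q l).eval u) * X ^ (ρ - l).toNat).eval t =
      ∑ l ∈ s, t ^ (ρ - l).toNat * (Q l).eval u := by
    intro u t
    simp only [eval_finsetSum, eval_mul, eval_C, eval_pow, eval_X, mul_comm]
  have hzero : ∑ l ∈ s, C ((Q l).eval u₀) * X ^ (ρ - l).toNat = (0 : ℂ[X]) := by
    refine Polynomial.funext fun t => ?_
    rw [eval_zero]
    -- The point `u₀` is approached radially from outside the disk.
    refine eval_eq_zero_of_tendsto (l := 𝓝[>] (0 : ℝ)) (c := 0)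
      (f := fun r : ℝ => ∑ l ∈ s, C ((Q l).eval ((1 + r : ℝ) * u₀)) * X ^ (ρ - l).toNat)
      (inv_pos.2 hR₀) (N := s.sup fun l => (ρ - l).toNat) ?_ ?_ ?_ ?_ t
    · intro r
      refine natDegree_sum_le_of_forall_le _ _ fun l hl => ?_
      exact (natDegree_C_mul_X_pow_le _ _).trans (Finset.le_sup (f := fun l => (ρ - l).toNat) hl)
    · filter_upwards [self_mem_nhdsWithin] with r hr v hv
      have hr : 0 < r := hr
      have hu : 1 < ‖((1 + r : ℝ) : ℂ) * u₀‖ := by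
        rw [norm_mul, hone, mul_one, Complex.norm_of_nonneg (by linarith)]
        linarith
      rw [IsRoot.def, hev]
      rcases eq_or_ne v 0 with rfl | hv0
      · rw [hK0]
        exact fun h0 => absurd (hle _ h0) (not_le.2 hu)
      · exact hK v _ hv0 (by simpa using hv) hu
    · intro v
      simp only [hev]
      have hcont : Continuous fun r : ℝ =>
          ∑ l ∈ s, v ^ (ρ - l).toNat * (Q l).eval (((1 + r : ℝ) : ℂ) * u₀) := by
        fun_prop
      exact (hcont.tendsto' 0 _ (by simp)).mono_left nhdsWithin_le_nhds
    · rw [hev, hK0]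
      exact hu₀
  have hcoeff := congrArg (fun p : ℂ[X] => p.coeff (ρ - k).toNat) hzero
  simp only [finsetSum_coeff, coeff_C_mul_X_pow, coeff_zero] at hcoeff
  rw [Finset.sum_eq_single_of_mem k hk] at hcoeff
  · simpa using hcoeff
  · intro l hl hlk
    have := hs l hl
    have := hs k hk
    exact if_neg (by omega)

/-! ### The symbol of a non-degenerate operator -/

section Symbol

variable {n : ℕ} {T : PolyLE n →ₗ[ℂ] ℂ[X]} {ρ : ℤ}

theorem onMonomial_last_ne_zero (hT : IsNondegenerate T) (hρ : fuchsIndex T = (ρ : WithBot ℤ)) :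
    onMonomial T (Fin.last n) ≠ 0 := by
  intro h0
  rw [IsNondegenerate, hρ, degreeShift, h0, degree_zero] at hT
  exact WithBot.bot_ne_coe hT

theorem natDegree_onMonomial_last (hT : IsNondegenerate T)
    (hρ : fuchsIndex T = (ρ : WithBot ℤ)) :
    ((onMonomial T (Fin.last n)).natDegree : ℤ) = n + ρ := by
  have h0 := onMonomial_last_ne_zero hT hρ
  rw [IsNondegenerate, hρ, degreeShift, degree_eq_natDegree h0] at hT
  have h1 : ((((onMonomial T (Fin.last n)).natDegree : ℤ) - (((Fin.last n : Fin (n + 1)) : ℕ) : ℤ)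
    : ℤ) : WithBot ℤ) = ρ := hT
  have h2 := WithBot.coe_injective h1
  rw [Fin.val_last] at h2
  omega

theorem fuchsIndex_mem_Icc (hT : IsNondegenerate T) (hρ : fuchsIndex T = (ρ : WithBot ℤ)) :
    ρ ∈ Finset.Icc (-(n : ℤ)) ρ := by
  have := natDegree_onMonomial_last hT hρ
  rw [Finset.mem_Icc]
  omega

theorem natDegree_symbolPart_fuchsIndex (hT : IsNondegenerate T)
    (hρ : fuchsIndex T = (ρ : WithBot ℤ)) : (symbolPart T ρ).natDegree = n ∧ symbolPart T ρ ≠ 0 := by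
  have hd := natDegree_onMonomial_last hT hρ
  have hc : (symbolPart T ρ).coeff n ≠ 0 := by
    rw [symbolPart, finsetSum_coeff, Finset.sum_eq_single (Fin.last n)]
    · have h1 : (((Fin.last n : Fin (n + 1)) : ℕ) : ℤ) + ρ =
          ((onMonomial T (Fin.last n)).natDegree : ℤ) := by rw [hd, Fin.val_last]
      rw [h1, symbol_coeff, if_pos (by positivity), Int.toNat_natCast, Fin.val_last,
        coeff_monomial_same, Nat.choose_self, Nat.cast_one, one_smul]
      exact leadingCoeff_ne_zero.2 (onMonomial_last_ne_zero hT hρ)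
    · intro j _ hj
      rw [coeff_monomial, if_neg]
      exact fun h => hj (Fin.ext h)
    · simp
  refine ⟨natDegree_eq_of_le_of_coeff_ne_zero (symbolPart_natDegree_le T ρ) hc, ?_⟩
  intro h0
  rw [h0] at hc
  exact hc (coeff_zero n)

/-- The coefficient of `x ^ (n + ρ)` in `G_T(x, y)` comes from `T (x ^ n)` alone. -/
theorem symbol_eval_C_ne_zero (hT : IsNondegenerate T) (hρ : fuchsIndex T = (ρ : WithBot ℤ))
    {y : ℂ} (hy : y ≠ 0) : (symbol T).eval (C y) ≠ 0 := by
  have hd := natDegree_onMonomial_last hT hρ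
  intro h0
  have h1 := congrArg (fun p : ℂ[X] => p.coeff (onMonomial T (Fin.last n)).natDegree) h0
  simp only [symbol, eval_finsetSum, finsetSum_coeff, eval_monomial, ← C_pow, coeff_mul_C,
    coeff_smul, coeff_zero, smul_eq_mul] at h1
  rw [Finset.sum_eq_single (Fin.last n)] at h1
  · rw [Fin.val_last, Nat.choose_self, Nat.cast_one, one_mul] at h1
    exact mul_ne_zero (leadingCoeff_ne_zero.2 (onMonomial_last_ne_zero hT hρ)) (pow_ne_zero _ hy) h1
  · intro i _ hi
    have hlt : (i : ℕ) < n := by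
      have h2 := i.2
      have h3 : (i : ℕ) ≠ n := fun h => hi (Fin.ext h)
      omega
    have hc : (onMonomial T i).coeff (onMonomial T (Fin.last n)).natDegree = 0 := by
      rcases eq_or_ne (onMonomial T i) 0 with hz | hz
      · rw [hz, coeff_zero]
      · have := natDegree_le_of_fuchsIndex T hρ i hz
        exact coeff_eq_zero_of_natDegree_lt (by omega)
    rw [hc, mul_zero, zero_mul]
  · simp

theorem degree_one_add_C_mul_X_pow {y : ℂ} (hy : y ≠ 0) :
    ((1 + C y * X : ℂ[X]) ^ n).degree = (n : WithBot ℕ) := by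
  have h : (1 + C y * X : ℂ[X]).degree = 1 := by
    rw [add_comm, ← C_1]
    exact degree_linear hy
  rw [degree_pow, h, nsmul_eq_mul, mul_one]

/-- The powers `(1 + y X) ^ n` are test polynomials: if the disks of radius at least `R₀` are
invariant, then `G_T(x, u / x) ≠ 0` for `R₀ < |x|` and `1 < |u|`. -/
theorem sum_symbolPart_ne_zero_of_isInvariant (hT : IsNondegenerate T)
    (hρ : fuchsIndex T = (ρ : WithBot ℤ)) {R₀ : ℝ} (hR₀ : 0 < R₀)
    (hinv : ∀ R : ℝ, R₀ ≤ R → IsInvariant T (Metric.closedBall (0 : ℂ) R)) {x u : ℂ}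
    (hx : R₀ < ‖x‖) (hu : 1 < ‖u‖) :
    ∑ l ∈ Finset.Icc (-(n : ℤ)) ρ, x ^ l * (symbolPart T l).eval u ≠ 0 := by
  have hx0 : x ≠ 0 := norm_pos_iff.1 (hR₀.trans hx)
  have hu0 : u ≠ 0 := norm_pos_iff.1 (one_pos.trans hu)
  have hy : u / x ≠ 0 := div_ne_zero hu0 hx0
  intro h0
  have hsum := symbol_eq_sum T hρ x (u / x) hx0
  rw [mul_div_cancel₀ u hx0, h0, symbol_eval_eq] at hsum
  have hne := symbol_eval_C_ne_zero hT hρ hy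
  rw [symbol_eval_eq] at hne
  have hroots : ∀ z, ((1 + C (u / x) * X : ℂ[X]) ^ n).IsRoot z →
      z ∈ Metric.closedBall (0 : ℂ) (max R₀ (‖x‖ / ‖u‖)) := by
    intro z hz
    rw [IsRoot.def, eval_pow] at hz
    have h1 := eq_zero_of_pow_eq_zero hz
    simp only [eval_add, eval_one, eval_mul, eval_C, eval_X] at h1
    have h2 : z = -(x / u) := by
      field_simp at h1 ⊢
      linear_combination h1
    rw [mem_closedBall_zero_iff, h2, norm_neg, norm_div]
    exact le_max_right _ _
  have hmem := ((hinv _ (le_max_left R₀ (‖x‖ / ‖u‖))).2 _ (degree_one_add_C_mul_X_pow hy)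
    hroots).resolve_left hne x hsum
  rw [mem_closedBall_zero_iff] at hmem
  refine absurd hmem (not_le.2 (max_lt hx ?_))
  exact div_lt_self (norm_pos_iff.2 hx0) hu

/-- Grace's theorem reduces the invariance of a disk to the test polynomials `(X - w) ^ n`. -/
theorem isInvariant_closedBall_of_sum_symbolPart_ne_zero
    (hρ : fuchsIndex T = (ρ : WithBot ℤ)) {R : ℝ} (hR : 0 < R)
    (hsum : ∀ x u : ℂ, R < ‖x‖ → 1 < ‖u‖ →
      ∑ l ∈ Finset.Icc (-(n : ℤ)) ρ, x ^ l * (symbolPart T l).eval u ≠ 0)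
    (hlast : ∀ x, (onMonomial T (Fin.last n)).IsRoot x → ‖x‖ ≤ R) :
    IsInvariant T (Metric.closedBall (0 : ℂ) R) := by
  refine ⟨Metric.isClosed_closedBall, fun p hp hroots => Or.inr fun x hx => ?_⟩
  by_contra hxR
  rw [mem_closedBall_zero_iff, not_le] at hxR
  have hx0 : x ≠ 0 := norm_pos_iff.1 (hR.trans hxR)
  obtain ⟨M, hM⟩ := LinearMap.exists_extend ((leval x).comp T)
  have hMapp : ∀ (q : ℂ[X]) (hq : q.degree ≤ (n : WithBot ℕ)), M q = (app T q hq).eval x :=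
    fun q hq => LinearMap.congr_fun hM ⟨q, mem_degreeLE.2 hq⟩
  have hp0 : p ≠ 0 := by
    rintro rfl
    rw [degree_zero] at hp
    exact WithBot.bot_ne_coe hp
  have hpn : p.natDegree = n := natDegree_eq_of_degree_eq_some hp
  refine functional_ne_zero_of_roots_mem_disk hR.le M hp0
    (fun z hz => mem_closedBall_zero_iff.1 (hroots z hz)) (fun w hw => ?_)
    ((hMapp p hp.le).trans hx)
  rw [hpn]
  rcases eq_or_ne w 0 with rfl | hw0
  · rw [C_0, sub_zero, ← Fin.val_last n, hMapp _ (degree_X_pow_le_of_fin (Fin.last n))]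
    exact fun h0 => absurd (hlast x h0) (not_le.2 hxR)
  · have e : (X - C w) ^ n = (-w) ^ n • (1 + C (-w⁻¹) * X) ^ n := by
      have : C w * C w⁻¹ = (1 : ℂ[X]) := by rw [← C_mul, mul_inv_cancel₀ hw0, C_1]
      rw [smul_eq_C_mul, C_pow, ← mul_pow]
      congr 1
      rw [C_neg, C_neg]
      linear_combination -X * this
    rw [e, map_smul, smul_eq_mul, hMapp _ (degree_one_add_pow_le n _), ← symbol_eval_eq,
      symbol_eq_sum T hρ x _ hx0]
    refine mul_ne_zero (pow_ne_zero _ (neg_ne_zero.2 hw0)) (hsum x _ hxR ?_)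
    rw [norm_mul, norm_neg, norm_inv, ← div_eq_mul_inv, one_lt_div (norm_pos_iff.2 hw0)]
    exact hw.trans_lt hxR

end Symbol

/-! ### Coprimality of the cofactors and boundedness of zeros -/

theorem IsGCDOf.exists_not_isRoot_div {s : Finset ℤ} {P : ℤ → ℂ[X]} {g : ℂ[X]}
    (hg : IsGCDOf s P g) (hg0 : g ≠ 0) (z : ℂ) : ∃ l ∈ s, ¬ (P l / g).IsRoot z := by
  by_contra! hc
  have hdvd : g * (X - C z) ∣ g := hg.2 _ fun l hl => by
    have h1 := mul_dvd_mul_left g (dvd_iff_isRoot.2 (hc l hl))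
    rwa [EuclideanDomain.mul_div_cancel' hg0 (hg.1 l hl)] at h1
  have h2 : g * (X - C z) ∣ g * 1 := by rwa [mul_one]
  exact not_isUnit_X_sub_C z (isUnit_of_dvd_one ((mul_dvd_mul_iff_left hg0).1 h2))

theorem exists_forall_root_norm_le {p : ℂ[X]} (hp : p ≠ 0) :
    ∃ B : ℝ, ∀ z, p.IsRoot z → ‖z‖ ≤ B := by
  obtain ⟨B, hB⟩ := (p.rootSet_finite ℂ).isBounded.exists_norm_le
  exact ⟨B, fun z hz => hB z ((mem_rootSet_of_ne hp).2 (by simpa using hz))⟩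

end FuchsDisk

theorem mainTheorem4 (n : ℕ) (T : FuchsDisk.PolyLE n →ₗ[ℂ] Polynomial ℂ)
    (hT : FuchsDisk.IsNondegenerate T)
    (ρ : ℤ) (hρ : FuchsDisk.fuchsIndex T = (ρ : WithBot ℤ))
    (g : Polynomial ℂ)
    (hg : FuchsDisk.IsGCDOf (Finset.Icc (-(n : ℤ)) ρ) (FuchsDisk.symbolPart T) g) :
    (∃ R₀ : ℝ, 0 < R₀ ∧ ∀ R : ℝ, R₀ ≤ R →
        FuchsDisk.IsInvariant T (Metric.closedBall (0 : ℂ) R)) ↔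
      (∀ z : ℂ, g.IsRoot z → ‖z‖ ≤ 1) ∧
        (∀ z : ℂ, (FuchsDisk.symbolPart T ρ / g).IsRoot z → ‖z‖ < 1) := by
  have hmem := FuchsDisk.fuchsIndex_mem_Icc hT hρ
  have hle : ∀ l ∈ Finset.Icc (-(n : ℤ)) ρ, l ≤ ρ := fun l hl => (Finset.mem_Icc.1 hl).2
  obtain ⟨hPn, hP0⟩ := FuchsDisk.natDegree_symbolPart_fuchsIndex hT hρ
  have hg0 : g ≠ 0 := ne_zero_of_dvd_ne_zero hP0 (hg.1 ρ hmem)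
  have hfac : ∀ l ∈ Finset.Icc (-(n : ℤ)) ρ,
      g * (FuchsDisk.symbolPart T l / g) = FuchsDisk.symbolPart T l := fun l hl =>
    EuclideanDomain.mul_div_cancel' hg0 (hg.1 l hl)
  have hQ0 : FuchsDisk.symbolPart T ρ / g ≠ 0 := by
    intro h0
    have h1 := hfac ρ hmem
    rw [h0, mul_zero] at h1
    exact hP0 h1.symm
  have hsum : ∀ x u : ℂ,
      ∑ l ∈ Finset.Icc (-(n : ℤ)) ρ, x ^ l * (FuchsDisk.symbolPart T l).eval u =
      g.eval u * ∑ l ∈ Finset.Icc (-(n : ℤ)) ρ,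
        x ^ l * (FuchsDisk.symbolPart T l / g).eval u := by
    intro x u
    rw [Finset.mul_sum]
    refine Finset.sum_congr rfl fun l hl => ?_
    rw [← hfac l hl, Polynomial.eval_mul, hfac l hl]
    ring
  constructor
  · rintro ⟨R₀, hR₀, hinv⟩
    have hne : ∀ x u : ℂ, R₀ < ‖x‖ → 1 < ‖u‖ → _ ≠ (0 : ℂ) := fun x u hx hu =>
      hsum x u ▸ FuchsDisk.sum_symbolPart_ne_zero_of_isInvariant hT hρ hR₀ hinv hx hu
    refine ⟨fun z hz => ?_, fun z hz => ?_⟩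
    · by_contra hc
      have hx : R₀ < ‖((R₀ + 1 : ℝ) : ℂ)‖ := by
        rw [Complex.norm_of_nonneg (by linarith)]
        linarith
      exact left_ne_zero_of_mul (hne _ z hx (not_le.1 hc)) hz
    · exact FuchsDisk.norm_root_lt_one_of_sum_zpow_mul_ne_zero
        (Q := fun l => FuchsDisk.symbolPart T l / g) hmem hle hQ0 hR₀
        (fun x u hx hu => right_ne_zero_of_mul (hne x u hx hu))
        (hg.exists_not_isRoot_div hg0) hz
  · rintro ⟨hgz, hQz⟩
    have hdeg : ∀ l ∈ Finset.Icc (-(n : ℤ)) ρ, (FuchsDisk.symbolPart T l / g).natDegree ≤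
        (FuchsDisk.symbolPart T ρ / g).natDegree := by
      intro l hl
      rcases eq_or_ne (FuchsDisk.symbolPart T l / g) 0 with h0 | h0
      · rw [h0, Polynomial.natDegree_zero]
        exact Nat.zero_le _
      · have h1 := FuchsDisk.symbolPart_natDegree_le T l
        have h2 := Polynomial.natDegree_mul hg0 h0
        have h3 := Polynomial.natDegree_mul hg0 hQ0
        rw [hfac l hl] at h2
        rw [hfac ρ hmem] at h3
        omega
    obtain ⟨R₁, hR₁, hne⟩ := FuchsDisk.exists_sum_zpow_mul_ne_zero
      (Q := fun l => FuchsDisk.symbolPart T l / g) hmem hle hQ0 hdeg hQz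
    obtain ⟨B, hB⟩ :=
      FuchsDisk.exists_forall_root_norm_le (FuchsDisk.onMonomial_last_ne_zero hT hρ)
    refine ⟨max R₁ B, lt_max_of_lt_left hR₁, fun R hR => ?_⟩
    have hR₁R : R₁ ≤ R := (le_max_left _ _).trans hR
    refine FuchsDisk.isInvariant_closedBall_of_sum_symbolPart_ne_zero hρ (hR₁.trans_le hR₁R)
      (fun x u hx hu => ?_) (fun x hx => (hB x hx).trans ((le_max_right _ _).trans hR))
    rw [hsum]
    exact mul_ne_zero (fun h0 => absurd (hgz u h0) (not_le.2 hu))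
      (hne x u (hR₁R.trans_lt hx) hu.le)
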